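/- Let $\mathcal{A}$ be a commutative $\mathbb{C}$-algebra, let $\mathcal{C}=\mathcal{A}[[t_1,t_2,\dotsc]]$, and let $\mathcal{R}=\mathcal{C}[[x]]$ or $\mathcal{R}=\mathcal{C}((x))$. Write $\partial=\partial/\partial x$. A microdifferential operator is a formal series $P=\sum_{k\in\mathbb{Z}}a_k\partial^k$ with $a_k\in\mathcal{R}$ and $a_k=0$ for $k\gg0$; such operators are multiplied by the extended Leibniz rule $$\Bigl(\sum_k a_k\partial^k\Bigr)\Bigl(\sum_k b_k\partial^k\Bigr)=\sum_{k\in\mathbb{Z}}\Bigl(\sum_{l+m-r=k,\ r\ge0}\binom{l}{r}a_l\,(\partial^r b_m)\Bigr)\partial^k .$$ Put $[P,Q]=PQ-QP$ and $\frac{\partial P}{\partial t_n}=\sum_k\frac{\partial a_k}{\partial t_n}\partial^k$. The operator $P$ is a differential operator if $a_k=0$ for all $k<0$, and it is monic of order $n$ if $a_n=1$ and $a_k=0$ for all $k>n$. Let $(B_n)_{n\ge1}$ be a sequence of differential operators over $\mathcal{R}$, with $B_n=\partial^n+b_{n,n-1}\partial^{n-1}+\dotsb+b_{n,0}$ monic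 of order $n$, which satisfies the Zakharov–Shabat equations $$\frac{\partial B_n}{\partial t_m}-\frac{\partial B_m}{\partial t_n}+[B_n,B_m]=0\qquad(n,m=1,2,\dotsc).$$ Then there exists a monic first-order microdifferential operator $L=\partial+u_0+u_{-1}\partial^{-1}+u_{-2}\partial^{-2}+\dotsb$ with $u_i\in\mathcal{R}$ such that $$\frac{\partial L}{\partial t_n}=[B_n,L]\qquad(n=1,2,\dotsc).$$ Moreover, if $b_{n,n-1}=0$ for all $n\ge1$, then $L$ can be chosen with $u_0=0$, that is, $L=\partial+u_{-1}\partial^{-1}+u_{-2}\partial^{-2}+\dotsb$. -/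

import Mathlib

noncomputable section

universe u

/-- Microdifferential operators `∑_{k ∈ ℤ} a_k ∂^k` (`a_k ∈ R`, `a_k = 0` for `k ≫ 0`) over a
commutative ring `R`, where `∂` acts on `R` by `D`. The map `D` is a phantom parameter of the
type; it enters through the product. -/
@[ext]
structure MicroDiffOp {R : Type u} [CommRing R] (D : R →+ R) where
  /-- The coefficient `a_k` of `∂^k`. -/
  coeff : ℤ → R
  eventually_zero : ∃ N : ℤ, ∀ k : ℤ, N < k → coeff k = 0

namespace MicroDiffOp

variable {R : Type u} [CommRing R] {D : R →+ R}

instance : Zero (MicroDiffOp D) := ⟨⟨fun _ => 0, 0, fun _ _ => rfl⟩⟩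

instance : Add (MicroDiffOp D) :=
  ⟨fun P Q => ⟨fun k => P.coeff k + Q.coeff k, by
    obtain ⟨N, hN⟩ := P.eventually_zero
    obtain ⟨M, hM⟩ := Q.eventually_zero
    refine ⟨max N M, fun k hk => ?_⟩
    rw [hN k (lt_of_le_of_lt (le_max_left _ _) hk), hM k (lt_of_le_of_lt (le_max_right _ _) hk),
      add_zero]⟩⟩

instance : Sub (MicroDiffOp D) :=
  ⟨fun P Q => ⟨fun k => P.coeff k - Q.coeff k, by
    obtain ⟨N, hN⟩ := P.eventually_zero
    obtain ⟨M, hM⟩ := Q.eventually_zero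
    refine ⟨max N M, fun k hk => ?_⟩
    rw [hN k (lt_of_le_of_lt (le_max_left _ _) hk), hM k (lt_of_le_of_lt (le_max_right _ _) hk),
      sub_zero]⟩⟩

/-- The summand `binom(l, r) a_l b_m^{(r)}` of the coefficient of `∂^k` in the product `P Q`, where
`p = (l, r)` and `m = k + r - l`. -/
def mulTerm (P Q : MicroDiffOp D) (k : ℤ) (p : ℤ × ℕ) : R :=
  Ring.choose p.1 p.2 • (P.coeff p.1 * D^[p.2] (Q.coeff (k + p.2 - p.1)))

theorem iterate_map_zero' (D : R →+ R) (r : ℕ) : D^[r] 0 = 0 := by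
  induction r with
  | zero => rfl
  | succ r ih => rw [Function.iterate_succ_apply', ih, map_zero]

theorem mulTerm_eq_zero {P Q : MicroDiffOp D} {N M : ℤ} (hN : ∀ k, N < k → P.coeff k = 0)
    (hM : ∀ k, M < k → Q.coeff k = 0) (k : ℤ) (p : ℤ × ℕ)
    (h : N < p.1 ∨ M < k + p.2 - p.1) : mulTerm P Q k p = 0 := by
  unfold mulTerm
  rcases h with h | h
  · rw [hN _ h, zero_mul, smul_zero]
  · rw [hM _ h, iterate_map_zero', mul_zero, smul_zero]

/-- Only finitely many summands of each coefficient of a product are nonzero, so the `finsum` in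
the definition of the product is a genuine finite sum. -/
theorem finite_support_mulTerm (P Q : MicroDiffOp D) (k : ℤ) :
    (Function.support (mulTerm P Q k)).Finite := by
  obtain ⟨N, hN⟩ := P.eventually_zero
  obtain ⟨M, hM⟩ := Q.eventually_zero
  refine ((Set.finite_Icc (k - M) N).prod (Set.finite_Iic (N + M - k).toNat)).subset ?_
  intro p hp
  have h : ¬ (N < p.1 ∨ M < k + p.2 - p.1) := fun h => hp (mulTerm_eq_zero hN hM k p h)
  simp only [Set.mem_prod, Set.mem_Icc, Set.mem_Iic]
  omega

/-- The product, by the extended Leibniz rule: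
`P Q = ∑_k (∑_{l + m - r = k, r ≥ 0} binom(l, r) a_l b_m^{(r)}) ∂^k`. -/
instance : Mul (MicroDiffOp D) :=
  ⟨fun P Q => ⟨fun k => ∑ᶠ p : ℤ × ℕ, mulTerm P Q k p, by
    obtain ⟨N, hN⟩ := P.eventually_zero
    obtain ⟨M, hM⟩ := Q.eventually_zero
    refine ⟨N + M, fun k hk => finsum_eq_zero_of_forall_eq_zero fun p => ?_⟩
    exact mulTerm_eq_zero hN hM k p (by omega)⟩⟩

/-- The commutator `[P, Q] = P Q - Q P`. -/
def commutator (P Q : MicroDiffOp D) : MicroDiffOp D := P * Q - Q * P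

/-- Coefficientwise application of an additive map `δ`. For `δ = ∂/∂t_n` on `R` this is
the operator `∂P/∂t_n`. -/
def mapCoeff (δ : R →+ R) (P : MicroDiffOp D) : MicroDiffOp D :=
  ⟨fun k => δ (P.coeff k), by
    obtain ⟨N, hN⟩ := P.eventually_zero
    exact ⟨N, fun k hk => by rw [hN k hk, map_zero]⟩⟩

/-- `P` is a differential operator: no negative powers of `∂` occur. -/
def IsDifferential (P : MicroDiffOp D) : Prop := ∀ k : ℤ, k < 0 → P.coeff k = 0

/-- `P = ∂^n + (terms of order < n)`. -/
def IsMonicOfOrder (P : MicroDiffOp D) (n : ℤ) : Prop :=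
  P.coeff n = 1 ∧ ∀ k : ℤ, n < k → P.coeff k = 0

/-- The Zakharov–Shabat equations
`∂B_n/∂t_m - ∂B_m/∂t_n + [B_n, B_m] = 0` for all `n, m ≥ 1`; here `δ n` is `∂/∂t_n` on `R`. -/
def ZakharovShabat (δ : ℕ+ → R →+ R) (B : ℕ+ → MicroDiffOp D) : Prop :=
  ∀ n m : ℕ+, mapCoeff (δ m) (B n) - mapCoeff (δ n) (B m) + commutator (B n) (B m) = 0

/-- The Lax equations `∂L/∂t_n = [B_n, L]` for all `n ≥ 1`. -/
def LaxEquations (δ : ℕ+ → R →+ R) (B : ℕ+ → MicroDiffOp D) (L : MicroDiffOp D) : Prop :=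
  ∀ n : ℕ+, mapCoeff (δ n) L = commutator (B n) L

end MicroDiffOp

/-- The ring `𝒞 = A[[t]]`, `t = (t_1, t_2, …)`. -/
abbrev TimeSeries (A : Type u) : Type u := MvPowerSeries ℕ+ A

/-- `∂ = d/dx` on `𝒞[[x]]`. -/
def powerSeriesDx (A : Type u) [CommRing A] :
    PowerSeries (TimeSeries A) →+ PowerSeries (TimeSeries A) :=
  (PowerSeries.derivative (TimeSeries A)).toLinearMap.toAddMonoidHom

/-- `∂/∂t_n` on `𝒞[[x]]`, acting on the coefficients of the powers of `x`. -/
def powerSeriesDt (A : Type u) [CommRing A] (n : ℕ+) :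
    PowerSeries (TimeSeries A) →+ PowerSeries (TimeSeries A) where
  toFun f := PowerSeries.mk fun k => MvPowerSeries.pderiv A n (PowerSeries.coeff k f)
  map_zero' := by ext1 k; simp
  map_add' f g := by ext1 k; simp

/-- `∂ = d/dx` on `𝒞((x))`. -/
def laurentSeriesDx (A : Type u) [CommRing A] :
    LaurentSeries (TimeSeries A) →+ LaurentSeries (TimeSeries A) :=
  (LaurentSeries.derivative (TimeSeries A)).toAddMonoidHom

/-- `∂/∂t_n` on `𝒞((x))`, acting on the coefficients of the powers of `x`. -/
def laurentSeriesDt (A : Type u) [CommRing A] (n : ℕ+) :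
    LaurentSeries (TimeSeries A) →+ LaurentSeries (TimeSeries A) where
  toFun f := HahnSeries.map f (MvPowerSeries.pderiv A n)
  map_zero' := by ext1; funext k; simp
  map_add' f g := by ext1; funext k; simp

end

universe u

/-! ### The ring of microdifferential operators: order filtration, associativity, leading
coefficients. -/

noncomputable section

namespace MicroDiffOp

/-! Put ∇_m P = ∂P/∂t_m - [B_m, P]. Each ∇_m is a derivation, and the Lax equations say that L is
horizontal: ∇_m L = 0 for all m. The Zakharov–Shabat equations read ∇_m B_n = ∂B_m/∂t_n, which has
order at most m - 1 however large n is. Hence the quotients F_n = B_{n+j} B_n⁻¹, monic of order j,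
satisfy ord ∇_m F_n → -∞ as n → ∞ (`exists_quotient`).

For j = 1 these quotients need not converge, but they can be corrected order by order. By
`leadingCoeff_const`, if successive terms of an asymptotically horizontal sequence differ in order
at most p, the coefficient e_n of ∂^p in the difference is, for large n, free of x and of any given
t_m. One subtracts c_n F_n, where F_n is now the quotient of order p and c_n = f - ∑_{k<n} e_k. Each
∂/∂t_m eventually kills c_n, so horizontality survives, and the sequence becomes stationary in order
p (`exists_stationary_correction`). A suitable f exists because a nonconstant monomial in t involves
some t_m, so only finitely many e_k contribute to its coefficient (`exists_timeSeries_sum`).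

Repeating this for p, p - 1, … and passing to the limit gives L (`exists_horizontal`). If all
b_{n,n-1} vanish, the quotients of order 1 eventually have no ∂^0 term, so the corrections can start
at p = -1 and leave u_0 = 0. -/

/-- The additive map `D` satisfies the Leibniz rule. -/
class IsLeibniz {R : Type u} [CommRing R] (D : R →+ R) : Prop where
  map_mul : ∀ a b : R, D (a * b) = a * D b + D a * b

section Leibniz

variable {R : Type u} [CommRing R] (D : R →+ R)

theorem IsLeibniz.map_one [IsLeibniz D] : D 1 = 0 := by
  have h := IsLeibniz.map_mul (D := D) 1 1
  simpa using h

theorem iterate_map_add (r : ℕ) (a b : R) : D^[r] (a + b) = D^[r] a + D^[r] b :=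
  _root_.iterate_map_add D r a b

theorem iterate_leibniz [IsLeibniz D] (r : ℕ) (a b : R) :
    D^[r] (a * b) = ∑ ij ∈ Finset.HasAntidiagonal.antidiagonal r, (r.choose ij.1) • (D^[ij.1] a * D^[ij.2] b) := by
  induction r with
  | zero => simp
  | succ r ih =>
    rw [Finset.sum_antidiagonal_choose_succ_nsmul (fun i j => D^[i] a * D^[j] b),
      Function.iterate_succ_apply', ih, map_sum, ← Finset.sum_add_distrib]
    refine Finset.sum_congr rfl fun ij hij => ?_
    rw [← Nat.choose_symm_of_eq_add (Finset.HasAntidiagonal.mem_antidiagonal.mp hij).symm, map_nsmul,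
      IsLeibniz.map_mul, smul_add, Function.iterate_succ_apply', Function.iterate_succ_apply']

theorem iterate_const_mul [IsLeibniz D] {c : R} (hc : D c = 0) (r : ℕ) (a : R) :
    D^[r] (c * a) = c * D^[r] a := by
  induction r with
  | zero => rfl
  | succ r ih => rw [Function.iterate_succ_apply', Function.iterate_succ_apply', ih,
      IsLeibniz.map_mul, hc, zero_mul, add_zero]

end Leibniz

variable {R : Type u} [CommRing R] {D : R →+ R}

instance : Neg (MicroDiffOp D) :=
  ⟨fun P => ⟨fun k => -P.coeff k, P.eventually_zero.imp fun N hN k hk => by rw [hN k hk, neg_zero]⟩⟩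

instance : SMul ℕ (MicroDiffOp D) :=
  ⟨fun n P => ⟨fun k => n • P.coeff k,
    P.eventually_zero.imp fun N hN k hk => by rw [hN k hk, smul_zero]⟩⟩

instance : SMul ℤ (MicroDiffOp D) :=
  ⟨fun n P => ⟨fun k => n • P.coeff k,
    P.eventually_zero.imp fun N hN k hk => by rw [hN k hk, smul_zero]⟩⟩

/-- Left multiplication of all coefficients by an element of `R`. -/
instance : SMul R (MicroDiffOp D) :=
  ⟨fun c P => ⟨fun k => c * P.coeff k,
    P.eventually_zero.imp fun N hN k hk => by rw [hN k hk, mul_zero]⟩⟩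

theorem coeff_injective : Function.Injective (coeff : MicroDiffOp D → ℤ → R) :=
  fun _ _ h => MicroDiffOp.ext h

instance : AddCommGroup (MicroDiffOp D) :=
  coeff_injective.addCommGroup coeff rfl (fun _ _ => rfl) (fun _ => rfl) (fun _ _ => rfl)
    (fun _ _ => rfl) (fun _ _ => rfl)

@[simp] theorem coeff_zero (k : ℤ) : (0 : MicroDiffOp D).coeff k = 0 := rfl
@[simp] theorem coeff_add (P Q : MicroDiffOp D) (k : ℤ) :
    (P + Q).coeff k = P.coeff k + Q.coeff k := rfl
@[simp] theorem coeff_sub (P Q : MicroDiffOp D) (k : ℤ) :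
    (P - Q).coeff k = P.coeff k - Q.coeff k := rfl
@[simp] theorem coeff_neg (P : MicroDiffOp D) (k : ℤ) : (-P).coeff k = -P.coeff k := rfl
@[simp] theorem coeff_smul (c : R) (P : MicroDiffOp D) (k : ℤ) :
    (c • P).coeff k = c * P.coeff k := rfl
@[simp] theorem coeff_mapCoeff (δ : R →+ R) (P : MicroDiffOp D) (k : ℤ) :
    (mapCoeff δ P).coeff k = δ (P.coeff k) := rfl

/-- Extraction of the coefficient of `∂^k` as an additive map. -/
def coeffHom (k : ℤ) : MicroDiffOp D →+ R where
  toFun P := P.coeff k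
  map_zero' := rfl
  map_add' _ _ := rfl

theorem coeff_sum {ι : Type*} (s : Finset ι) (P : ι → MicroDiffOp D) (k : ℤ) :
    (∑ i ∈ s, P i).coeff k = ∑ i ∈ s, (P i).coeff k :=
  map_sum (coeffHom k) P s

/-- `P` has order at most `N`. -/
def OrdLE (P : MicroDiffOp D) (N : ℤ) : Prop := ∀ k : ℤ, N < k → P.coeff k = 0

theorem exists_ordLE (P : MicroDiffOp D) : ∃ N, OrdLE P N := P.eventually_zero

theorem IsMonicOfOrder.ordLE {P : MicroDiffOp D} {n : ℤ} (h : P.IsMonicOfOrder n) : OrdLE P n := h.2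

namespace OrdLE

variable {P Q : MicroDiffOp D} {N M : ℤ}

theorem mono (h : OrdLE P N) (hNM : N ≤ M) : OrdLE P M := fun k hk => h k (hNM.trans_lt hk)

theorem zero : OrdLE (0 : MicroDiffOp D) N := fun _ _ => rfl

theorem add (hP : OrdLE P N) (hQ : OrdLE Q N) : OrdLE (P + Q) N := fun k hk => by
  rw [coeff_add, hP k hk, hQ k hk, add_zero]

theorem sub (hP : OrdLE P N) (hQ : OrdLE Q N) : OrdLE (P - Q) N := fun k hk => by
  rw [coeff_sub, hP k hk, hQ k hk, sub_zero]

theorem sub_comm (h : OrdLE (P - Q) N) : OrdLE (Q - P) N := fun k hk => by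
  have := h k hk
  rw [coeff_sub, sub_eq_zero] at this
  rw [coeff_sub, this, sub_self]

theorem trans {S : MicroDiffOp D} (h : OrdLE (P - Q) N) (h' : OrdLE (Q - S) N) :
    OrdLE (P - S) N := by
  have := h.add h'
  rwa [sub_add_sub_cancel] at this

theorem smul (c : R) (h : OrdLE P N) : OrdLE (c • P) N := fun k hk => by
  rw [coeff_smul, h k hk, mul_zero]

theorem mapCoeff (δ : R →+ R) (h : OrdLE P N) : OrdLE (mapCoeff δ P) N := fun k hk => by
  rw [coeff_mapCoeff, h k hk, map_zero]

theorem sum {ι : Type*} {s : Finset ι} {P : ι → MicroDiffOp D} (h : ∀ i ∈ s, OrdLE (P i) N) :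
    OrdLE (∑ i ∈ s, P i) N := fun k hk => by
  rw [coeff_sum]
  exact Finset.sum_eq_zero fun i hi => h i hi k hk

theorem of_coeff_eq_zero (h : OrdLE P N) (h0 : P.coeff N = 0) : OrdLE P (N - 1) := fun k hk => by
  rcases eq_or_lt_of_le (show N ≤ k by lia) with rfl | hlt
  · exact h0
  · exact h k hlt

theorem mul (hP : OrdLE P N) (hQ : OrdLE Q M) : OrdLE (P * Q) (N + M) := fun k hk =>
  finsum_eq_zero_of_forall_eq_zero fun p => mulTerm_eq_zero hP hQ k p (by lia)

end OrdLE

theorem eq_zero_of_forall_ordLE {P : MicroDiffOp D} (h : ∀ N, OrdLE P N) : P = 0 :=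
  MicroDiffOp.ext (funext fun k => h (k - 1) k (by lia))

theorem coeff_mul (P Q : MicroDiffOp D) (k : ℤ) : (P * Q).coeff k = ∑ᶠ p, mulTerm P Q k p := rfl

theorem coeff_mul_eq_sum {P Q : MicroDiffOp D} {k : ℤ} {s : Finset (ℤ × ℕ)}
    (hs : ∀ p, p ∉ s → mulTerm P Q k p = 0) : (P * Q).coeff k = ∑ p ∈ s, mulTerm P Q k p :=
  finsum_eq_sum_of_support_subset _ fun p hp => by
    by_contra h
    exact hp (hs p h)

theorem add_mul_aux (P Q S : MicroDiffOp D) : (P + Q) * S = P * S + Q * S := by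
  ext k
  rw [coeff_add, coeff_mul, coeff_mul, coeff_mul,
    ← finsum_add_distrib (finite_support_mulTerm _ _ _) (finite_support_mulTerm _ _ _)]
  refine finsum_congr fun p => ?_
  simp only [mulTerm, coeff_add, add_mul, smul_add]

theorem mul_add_aux (P Q S : MicroDiffOp D) : P * (Q + S) = P * Q + P * S := by
  ext k
  rw [coeff_add, coeff_mul, coeff_mul, coeff_mul,
    ← finsum_add_distrib (finite_support_mulTerm _ _ _) (finite_support_mulTerm _ _ _)]
  refine finsum_congr fun p => ?_
  simp only [mulTerm, coeff_add, iterate_map_add, mul_add, smul_add]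

instance : NonUnitalNonAssocRing (MicroDiffOp D) where
  left_distrib := mul_add_aux
  right_distrib := add_mul_aux
  zero_mul P := by
    ext k
    exact finsum_eq_zero_of_forall_eq_zero fun p => by simp [mulTerm]
  mul_zero P := by
    ext k
    exact finsum_eq_zero_of_forall_eq_zero fun p => by simp [mulTerm]

/-- The monomial `a ∂^l`. -/
def monomial (D : R →+ R) (l : ℤ) (a : R) : MicroDiffOp D :=
  ⟨fun k => if k = l then a else 0, l, fun _ hk => if_neg hk.ne'⟩

theorem coeff_monomial (l : ℤ) (a : R) (k : ℤ) :
    (monomial D l a).coeff k = if k = l then a else 0 := rfl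

theorem ordLE_monomial (l : ℤ) (a : R) : OrdLE (monomial D l a) l := fun _ hk => if_neg hk.ne'

/-- An additive map that kills monomials and operators of sufficiently low order is zero. -/
theorem eq_zero_of_monomial {f : MicroDiffOp D →+ R} (hf : ∀ l a, f (monomial D l a) = 0)
    {N : ℤ} (hN : ∀ P, OrdLE P N → f P = 0) (P : MicroDiffOp D) : f P = 0 := by
  have key : ∀ (d : ℕ) (P : MicroDiffOp D), OrdLE P (N + d) → f P = 0 := by
    intro d
    induction d with
    | zero => intro P hP; exact hN P (by simpa using hP)
    | succ d ih =>
      intro P hP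
      have h : OrdLE (P - monomial D (N + (d + 1 : ℕ)) (P.coeff (N + (d + 1 : ℕ)))) (N + d) := by
        have := (hP.sub (ordLE_monomial _ (P.coeff (N + (d + 1 : ℕ))))).of_coeff_eq_zero
          (by simp [coeff_monomial])
        exact this.mono (by push_cast; lia)
      have h2 := ih _ h
      rwa [map_sub, hf, sub_zero] at h2
  obtain ⟨M, hM⟩ := P.exists_ordLE
  exact key (M - N).toNat P (hM.mono (by lia))

/-- The cutoff `T` is only a lower bound, so different products can be expanded over the same range.
-/
theorem coeff_monomial_mul {l : ℤ} {a : R} {Q : MicroDiffOp D} {M : ℤ} (hQ : OrdLE Q M) (k : ℤ)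
    {T : ℕ} (hT : l + M - k < T) : (monomial D l a * Q).coeff k =
      ∑ r ∈ Finset.range T, Ring.choose l r • (a * D^[r] (Q.coeff (k + r - l))) := by
  rw [coeff_mul_eq_sum (s := {l} ×ˢ Finset.range T)]
  · rw [Finset.sum_product]
    simp [mulTerm, coeff_monomial]
  · intro p hp
    by_cases h : p.1 = l
    · refine mulTerm_eq_zero (ordLE_monomial l a) hQ k p (Or.inr ?_)
      simp only [Finset.mem_product, Finset.mem_singleton, Finset.mem_range, h, true_and] at hp
      lia
    · simp [mulTerm, coeff_monomial, h]

theorem coeff_mul_monomial {n : ℤ} {c : R} {P : MicroDiffOp D} {N : ℤ} (hP : OrdLE P N) (k : ℤ)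
    {T : ℕ} (hT : N + n - k < T) : (P * monomial D n c).coeff k =
      ∑ s ∈ Finset.range T, Ring.choose (k + s - n) s • (P.coeff (k + s - n) * D^[s] c) := by
  have hinj : Function.Injective fun s : ℕ => (k + s - n, s) := fun _ _ h => (Prod.ext_iff.mp h).2
  rw [coeff_mul_eq_sum (s := (Finset.range T).map ⟨_, hinj⟩)]
  · rw [Finset.sum_map]
    refine Finset.sum_congr rfl fun s _ => ?_
    simp [mulTerm, coeff_monomial]
  · rintro ⟨l, s⟩ hp
    simp only [Finset.mem_map, Finset.mem_range, Function.Embedding.coeFn_mk, Prod.mk.injEq,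
      not_exists, not_and] at hp
    by_cases h : k + s - l = n
    · refine mulTerm_eq_zero hP (ordLE_monomial n c) k _ (Or.inl ?_)
      by_contra hlt
      exact hp s (by simp only at hlt; lia) (by lia) rfl
    · simp [mulTerm, coeff_monomial, h]

theorem coeff_monomial_mul_monomial (l m : ℤ) (a b : R) {k : ℤ} {r : ℕ} (h : l + m = k + r) :
    (monomial D l a * monomial D m b).coeff k = Ring.choose l r • (a * D^[r] b) := by
  rw [coeff_monomial_mul (ordLE_monomial m b) k (T := r + 1) (by push_cast; lia),
    Finset.sum_eq_single r]
  · rw [coeff_monomial, if_pos (by lia)]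
  · intro s _ hs
    rw [coeff_monomial, if_neg (by lia), iterate_map_zero', mul_zero, smul_zero]
  · simp

/-- The combinatorial core of associativity: C(l, r+i) C(r+i, r) = C(l, r) C(l-r, i), followed by
Vandermonde for (l - r) + m. -/
theorem sum_choose_mul_choose_mul_choose (l m : ℤ) (r s : ℕ) :
    ∑ ij ∈ Finset.HasAntidiagonal.antidiagonal s,
      Ring.choose l (r + ij.1) * ((r + ij.1).choose r : ℤ) * Ring.choose m ij.2 =
    Ring.choose l r * Ring.choose (l + m - r) s := by
  rw [show l + m - r = (l - r) + m by ring, Ring.add_choose_eq s (Commute.all _ _), Finset.mul_sum]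
  refine Finset.sum_congr rfl fun ij _ => ?_
  have h := Ring.choose_smul_choose l (Nat.le_add_right r ij.1)
  rw [Nat.add_sub_cancel_left, nsmul_eq_mul] at h
  rw [← mul_assoc, ← h]
  ring

/-- Both sides are combinations of a b^{(r)} c^{(s)} with r + s = l + m + n - k. On the left the
weight is C(l, r) C(l+m-r, s); on the right, spreading derivatives over b c^{(j)} gives the sum that
Vandermonde evaluates. -/
theorem monomial_mul_assoc [IsLeibniz D] (l m n : ℤ) (a b c : R) (k : ℤ) :
    ((monomial D l a * monomial D m b) * monomial D n c).coeff k =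
      (monomial D l a * (monomial D m b * monomial D n c)).coeff k := by
  have hab := (ordLE_monomial (D := D) l a).mul (ordLE_monomial m b)
  have hbc := (ordLE_monomial (D := D) m b).mul (ordLE_monomial n c)
  rcases lt_or_ge (l + m + n) k with hk | hk
  · rw [hab.mul (ordLE_monomial n c) k hk, (ordLE_monomial l a).mul hbc k (by lia)]
  obtain ⟨T, hT⟩ : ∃ T : ℕ, l + m + n = k + T := ⟨(l + m + n - k).toNat, by lia⟩
  rw [coeff_mul_monomial hab k (T := T + 1) (by push_cast; lia),
    coeff_monomial_mul hbc k (T := T + 1) (by push_cast; lia),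
    ← Finset.Nat.sum_antidiagonal_eq_sum_range_succ_mk (fun ij : ℕ × ℕ => Ring.choose l ij.1 •
      (a * D^[ij.1] ((monomial D m b * monomial D n c).coeff (k + ij.1 - l)))),
    ← Finset.Nat.sum_antidiagonal_eq_sum_range_succ_mk (fun ij : ℕ × ℕ =>
      Ring.choose (k + ij.1 - n) ij.1 •
      ((monomial D l a * monomial D m b).coeff (k + ij.1 - n) * D^[ij.1] c)),
    ← Finset.Nat.sum_antidiagonal_swap]
  trans ∑ rs ∈ Finset.HasAntidiagonal.antidiagonal T, ∑ ij ∈ Finset.HasAntidiagonal.antidiagonal rs.2,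
      (Ring.choose l (rs.1 + ij.1) * ((rs.1 + ij.1).choose rs.1 : ℤ) * Ring.choose m ij.2) •
        (a * (D^[rs.1] b * D^[rs.2] c))
  · refine Finset.sum_congr rfl fun rs hrs => ?_
    have hrs := Finset.HasAntidiagonal.mem_antidiagonal.mp hrs
    rw [← Finset.sum_smul, sum_choose_mul_choose_mul_choose, Prod.fst_swap,
      coeff_monomial_mul_monomial l m a b (r := rs.1) (by lia),
      show k + rs.2 - n = l + m - rs.1 by lia, smul_mul_assoc, smul_smul, mul_comm (Ring.choose l _),
      mul_assoc]
  · rw [Finset.sum_sigma']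
    trans ∑ ij ∈ Finset.HasAntidiagonal.antidiagonal T, ∑ pq ∈ Finset.HasAntidiagonal.antidiagonal ij.1,
      (Ring.choose l ij.1 * (ij.1.choose pq.1 : ℤ) * Ring.choose m ij.2) •
        (a * (D^[pq.1] b * D^[pq.2 + ij.2] c))
    · rw [Finset.sum_sigma']
      refine Finset.sum_nbij' (fun x => ⟨(x.1.1 + x.2.1, x.2.2), (x.1.1, x.2.1)⟩)
        (fun x => ⟨(x.2.1, x.2.2 + x.1.2), (x.2.2, x.1.2)⟩) ?_ ?_ ?_ ?_ ?_
      all_goals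
        rintro ⟨⟨i, j⟩, ⟨p, q⟩⟩ h
        simp only [Finset.mem_sigma, Finset.HasAntidiagonal.mem_antidiagonal] at h
        obtain ⟨h1, rfl⟩ := h
      · simp; lia
      · simp; lia
      · simp
      · simp
      · rfl
    · refine Finset.sum_congr rfl fun ij hij => ?_
      have hij := Finset.HasAntidiagonal.mem_antidiagonal.mp hij
      rw [coeff_monomial_mul_monomial m n b c (r := ij.2) (by lia), iterate_map_zsmul,
        iterate_leibniz, Finset.smul_sum, Finset.mul_sum, Finset.smul_sum]
      refine Finset.sum_congr rfl fun pq _ => ?_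
      rw [← Function.iterate_add_apply, ← natCast_zsmul, smul_smul, mul_smul_comm, smul_smul]
      congr 1
      ring

/-- A fixed coefficient of the associator is additive in each argument and vanishes when that
argument has low enough order, so monomials suffice, one argument at a time. -/
theorem mul_assoc_aux [IsLeibniz D] (P Q S : MicroDiffOp D) : (P * Q) * S = P * (Q * S) := by
  have key : ∀ (k : ℤ) (P Q S : MicroDiffOp D), ((P * Q) * S - P * (Q * S)).coeff k = 0 := by
    intro k P Q S
    have bound : ∀ {P Q S : MicroDiffOp D} {p q s : ℤ}, OrdLE P p → OrdLE Q q → OrdLE S s →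
        p + q + s < k → ((P * Q) * S - P * (Q * S)).coeff k = 0 := fun hP hQ hS h =>
      ((hP.mul hQ).mul hS).sub ((hP.mul (hQ.mul hS)).mono (by lia)) k h
    obtain ⟨p, hp⟩ := P.exists_ordLE
    obtain ⟨q, hq⟩ := Q.exists_ordLE
    obtain ⟨s, hs⟩ := S.exists_ordLE
    refine eq_zero_of_monomial (f := AddMonoidHom.mk'
      (fun P => ((P * Q) * S - P * (Q * S)).coeff k) fun P P' => ?_) (fun l a => ?_)
      (N := k - q - s - 1) (fun P hP => bound hP hq hs (by lia)) P
    · simp only [add_mul, coeff_add, coeff_sub]; ring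
    refine eq_zero_of_monomial (f := AddMonoidHom.mk' (fun Q => ((monomial D l a * Q) * S -
      monomial D l a * (Q * S)).coeff k) fun P P' => ?_) (fun m b => ?_)
      (N := k - l - s - 1) (fun Q hQ => bound (ordLE_monomial l a) hQ hs (by lia)) Q
    · simp only [add_mul, mul_add, coeff_add, coeff_sub]; ring
    refine eq_zero_of_monomial (f := AddMonoidHom.mk' (fun S =>
      ((monomial D l a * monomial D m b) * S - monomial D l a * (monomial D m b * S)).coeff k)
      fun P P' => ?_) (fun n c => ?_) (N := k - l - m - 1)
      (fun S hS => bound (ordLE_monomial l a) (ordLE_monomial m b) hS (by lia)) S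
    · simp only [mul_add, coeff_add, coeff_sub]; ring
    exact sub_eq_zero.mpr (monomial_mul_assoc l m n a b c k)
  exact sub_eq_zero.mp (MicroDiffOp.ext (funext fun k => key k P Q S))

instance [IsLeibniz D] : NonUnitalRing (MicroDiffOp D) where
  mul_assoc := mul_assoc_aux

theorem smul_mul (c : R) (P Q : MicroDiffOp D) : (c • P) * Q = c • (P * Q) := by
  ext k
  rw [coeff_smul, coeff_mul, coeff_mul, mul_finsum']
  · refine finsum_congr fun p => ?_
    simp only [mulTerm, coeff_smul, mul_smul_comm, mul_assoc]
  · exact finite_support_mulTerm _ _ _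

theorem mul_smul_of_const [IsLeibniz D] {c : R} (hc : D c = 0) (P Q : MicroDiffOp D) :
    P * (c • Q) = c • (P * Q) := by
  ext k
  rw [coeff_smul, coeff_mul, coeff_mul, mul_finsum']
  · refine finsum_congr fun p => ?_
    simp only [mulTerm, coeff_smul, iterate_const_mul D hc, mul_smul_comm]
    congr 1
    ring
  · exact finite_support_mulTerm _ _ _

theorem mapCoeff_mul {δ : R →+ R} [IsLeibniz δ] (hδ : ∀ a, δ (D a) = D (δ a))
    (P Q : MicroDiffOp D) : mapCoeff δ (P * Q) = mapCoeff δ P * Q + P * mapCoeff δ Q := by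
  have hit : ∀ (r : ℕ) (a : R), δ (D^[r] a) = D^[r] (δ a) := fun r a =>
    (Function.Commute.iterate_right (f := δ) (g := D) hδ r) a
  ext k
  rw [coeff_add, coeff_mapCoeff, coeff_mul, coeff_mul, coeff_mul,
    ← finsum_add_distrib (finite_support_mulTerm _ _ _) (finite_support_mulTerm _ _ _),
    AddMonoidHom.map_finsum δ (finite_support_mulTerm _ _ _)]
  refine finsum_congr fun p => ?_
  simp only [mulTerm, coeff_mapCoeff, map_zsmul, IsLeibniz.map_mul, hit, smul_add]
  rw [add_comm]

theorem coeff_mul_add {P Q : MicroDiffOp D} {N M : ℤ} (hP : OrdLE P N) (hQ : OrdLE Q M) :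
    (P * Q).coeff (N + M) = P.coeff N * Q.coeff M := by
  rw [coeff_mul_eq_sum (s := {(N, 0)})]
  · simp [mulTerm]
  · rintro ⟨l, r⟩ h
    simp only [Finset.mem_singleton, Prod.mk.injEq, not_and] at h
    exact mulTerm_eq_zero hP hQ _ _ (by simp only; lia)

theorem coeff_mul_add_sub_one {P Q : MicroDiffOp D} {N M : ℤ} (hP : OrdLE P N) (hQ : OrdLE Q M) :
    (P * Q).coeff (N + M - 1) =
      P.coeff N * Q.coeff (M - 1) + P.coeff (N - 1) * Q.coeff M + N * (P.coeff N * D (Q.coeff M)) := by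
  rw [coeff_mul_eq_sum (s := {(N, 0), (N - 1, 0), (N, 1)})]
  · rw [Finset.sum_insert (by simp; lia), Finset.sum_insert (by simp), Finset.sum_singleton, add_assoc]
    have h1 : N + M - 1 - N = M - 1 := by ring
    simp [mulTerm, h1]
  · rintro ⟨l, r⟩ h
    simp only [Finset.mem_singleton, Finset.mem_insert, Prod.mk.injEq, not_or, not_and] at h
    exact mulTerm_eq_zero hP hQ _ _ (by simp only; lia)

end MicroDiffOp

end

/-! ### Limits, division by monic operators, and covariant derivatives. -/

noncomputable section

namespace MicroDiffOp

variable {R : Type u} [CommRing R] {D : R →+ R}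

/-- A sequence of operators whose successive differences have orders tending to `-∞` converges. -/
theorem exists_limit {M : ℕ → MicroDiffOp D} {p : ℤ}
    (hM : ∀ k : ℕ, OrdLE (M (k + 1) - M k) (p - k)) :
    ∃ L : MicroDiffOp D, ∀ k : ℕ, OrdLE (L - M k) (p - k) := by
  have hstab : ∀ (k d : ℕ), OrdLE (M (k + d) - M k) (p - k) := by
    intro k d
    induction d with
    | zero => simpa using OrdLE.zero
    | succ d ih => exact ((hM (k + d)).mono (by push_cast; lia)).trans ih
  obtain ⟨N, hN⟩ := (M 0).exists_ordLE
  -- The coefficient of ∂^j no longer changes once the index exceeds p - j.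
  refine ⟨⟨fun j => (M (p - j + 1).toNat).coeff j, max p N, fun j hj => ?_⟩, fun k j hj => ?_⟩
  · rw [show (p - j + 1).toNat = 0 by lia]
    exact hN j (by lia)
  · have h := hstab (p - j + 1).toNat (k - (p - j + 1).toNat) j (by lia)
    rw [Nat.add_sub_cancel' (by lia), coeff_sub, sub_eq_zero] at h
    rw [coeff_sub, h]
    exact sub_self _

/-- Right division by a monic operator. -/
theorem exists_mul_eq_of_monic {B Q : MicroDiffOp D} {n q : ℤ} (hB : B.IsMonicOfOrder n)
    (hQ : OrdLE Q q) : ∃ X : MicroDiffOp D, OrdLE X (q - n) ∧ X * B = Q := by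
  -- Long division: since B is monic, each new monomial times B cancels the top coefficient of the
  -- remainder.
  let X : ℕ → MicroDiffOp D := Nat.rec 0 fun k Y =>
    Y + monomial D (q - n - k) ((Q - Y * B).coeff (q - k))
  have hX : ∀ k, X (k + 1) = X k + monomial D (q - n - k) ((Q - X k * B).coeff (q - k)) :=
    fun _ => rfl
  have hinv : ∀ k : ℕ, OrdLE (Q - X k * B) (q - k) := by
    intro k
    induction k with
    | zero => simpa [X] using hQ
    | succ k ih =>
      have hm := ordLE_monomial (D := D) (q - n - k) ((Q - X k * B).coeff (q - k))
      have h1 := hm.mul hB.ordLE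
      have h2 := coeff_mul_add hm hB.ordLE
      rw [show q - n - k + n = q - k by ring] at h1 h2
      rw [hB.1, coeff_monomial, if_pos rfl, mul_one] at h2
      rw [hX, add_mul, ← sub_sub, Nat.cast_succ, ← sub_sub]
      exact (ih.sub h1).of_coeff_eq_zero (by rw [coeff_sub (Q - X k * B), h2, sub_self])
  obtain ⟨L, hL⟩ := exists_limit (M := X) (p := q - n) fun k => by
    rw [hX, add_sub_cancel_left]
    exact ordLE_monomial _ _
  refine ⟨L, by simpa [X] using hL 0, ?_⟩
  refine (sub_eq_zero.mp (eq_zero_of_forall_ordLE fun N => ?_)).symm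
  have h := (hinv (q - N).toNat).sub (((hL (q - N).toNat).mul hB.ordLE).mono
    (show _ ≤ q - ((q - N).toNat : ℤ) by lia))
  rw [sub_mul, sub_sub, add_sub_cancel] at h
  exact h.mono (by lia)

theorem OrdLE.of_mul_monic {P B : MicroDiffOp D} {n q : ℤ} (hB : B.IsMonicOfOrder n)
    (h : OrdLE (P * B) (q + n)) : OrdLE P q := by
  have key : ∀ d : ℕ, OrdLE P (q + d) → OrdLE P q := by
    intro d
    induction d with
    | zero => intro h; simpa using h
    | succ d ih =>
      intro hP
      refine ih ((hP.of_coeff_eq_zero ?_).mono (by push_cast; lia))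
      have := coeff_mul_add hP hB.ordLE
      rw [hB.1, mul_one] at this
      rw [← this]
      exact h _ (by push_cast; lia)
  obtain ⟨N, hN⟩ := P.exists_ordLE
  exact key (N - q).toNat (hN.mono (by lia))

/-- The covariant derivative `P ↦ ∂P/∂t - [B, P]`. -/
def nabla (δ : R →+ R) (B : MicroDiffOp D) : MicroDiffOp D →+ MicroDiffOp D :=
  AddMonoidHom.mk' (fun P => mapCoeff δ P - commutator B P) fun P Q => by
    have h : mapCoeff δ (P + Q) = mapCoeff δ P + mapCoeff δ Q :=
      MicroDiffOp.ext (funext fun k => by simp)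
    simp only [commutator, h, mul_add, add_mul]
    abel

theorem nabla_apply (δ : R →+ R) (B P : MicroDiffOp D) :
    nabla δ B P = mapCoeff δ P - (B * P - P * B) := rfl

/-- The top coefficients of BP and PB agree, so the commutator loses one order. -/
theorem ordLE_nabla {δ : R →+ R} {B P : MicroDiffOp D} {m p : ℤ} (hm : 1 ≤ m)
    (hB : B.IsMonicOfOrder m) (hP : OrdLE P p) : OrdLE (nabla δ B P) (p + m - 1) := by
  refine ((hP.mapCoeff δ).mono (by lia)).sub ?_
  have h1 := hB.ordLE.mul hP
  rw [add_comm m p] at h1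
  refine (h1.sub (hP.mul hB.ordLE)).of_coeff_eq_zero ?_
  have h2 := coeff_mul_add hB.ordLE hP
  rw [add_comm m p] at h2
  rw [coeff_sub, h2, coeff_mul_add hP hB.ordLE, hB.1, one_mul, mul_one, sub_self]

variable [IsLeibniz D]

theorem nabla_mul {δ : R →+ R} [IsLeibniz δ] (hδ : ∀ a, δ (D a) = D (δ a))
    (B P Q : MicroDiffOp D) : nabla δ B (P * Q) = nabla δ B P * Q + P * nabla δ B Q := by
  simp only [nabla_apply, mapCoeff_mul hδ]
  noncomm_ring

theorem nabla_smul {δ : R →+ R} [IsLeibniz δ] {c : R} (hc : D c = 0) (B P : MicroDiffOp D) :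
    nabla δ B (c • P) = δ c • P + c • nabla δ B P := by
  simp only [nabla_apply, mul_smul_of_const hc, smul_mul]
  ext k
  simp only [coeff_sub, coeff_add, coeff_smul, coeff_mapCoeff, IsLeibniz.map_mul]
  ring

theorem coeff_commutator_sub_one {B P : MicroDiffOp D} {m p : ℤ} (hB : B.IsMonicOfOrder m)
    (hP : OrdLE P p) : (B * P - P * B).coeff (p + m - 1) = m * D (P.coeff p) := by
  have h1 := coeff_mul_add_sub_one hB.ordLE hP
  rw [add_comm m p] at h1
  rw [coeff_sub, h1, coeff_mul_add_sub_one hP hB.ordLE, hB.1, IsLeibniz.map_one]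
  ring

/-- For m ≥ 2 the time derivative, of order at most p, does not reach order p + m - 1; only the
commutator contributes. -/
theorem coeff_nabla {δ : R →+ R} {B P : MicroDiffOp D} {m p : ℤ} (hm : 2 ≤ m)
    (hB : B.IsMonicOfOrder m) (hP : OrdLE P p) :
    (nabla δ B P).coeff (p + m - 1) = -(m * D (P.coeff p)) := by
  rw [nabla_apply, coeff_sub, coeff_commutator_sub_one hB hP, hP.mapCoeff δ _ (by lia), zero_sub]

/-- If an operator and monic operators of all lower orders are almost horizontal for two covariant
derivatives of consecutive orders, then the leading coefficient of the first one is constant. -/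
theorem leadingCoeff_const {δ δ' : R →+ R} [IsAddTorsionFree R] [IsLeibniz δ] [IsLeibniz δ']
    {m : ℕ} (hm : m ≠ 0) {B B' Δ : MicroDiffOp D} {p : ℤ} {F : ℕ → MicroDiffOp D}
    (hB : B.IsMonicOfOrder m) (hB' : B'.IsMonicOfOrder (m + 1 : ℕ)) (hΔ : OrdLE Δ p)
    (hF : ∀ i, (F i).IsMonicOfOrder (p - i))
    (h : OrdLE (nabla δ B Δ) (p - 1)) (h' : OrdLE (nabla δ' B' Δ) (p - 1))
    (hFn : ∀ i < m, OrdLE (nabla δ B (F i)) (p - 1))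
    (hFn' : ∀ i < m, OrdLE (nabla δ' B' (F i)) (p - 1)) :
    D (Δ.coeff p) = 0 ∧ δ (Δ.coeff p) = 0 := by
  -- Expand Δ in the `F i` with coefficients killed by D. For r < m the remainder Y has order at
  -- most p - r and its ∇' has order at most p, below the order p - r + m where -(m + 1) D(Y_{p-r})
  -- appears; hence Y_{p-r} is again constant.
  have key : ∀ r ≤ m, ∃ e : ℕ → R, (∀ i, D (e i) = 0) ∧ (r ≠ 0 → e 0 = Δ.coeff p) ∧
      OrdLE (Δ - ∑ i ∈ Finset.range r, e i • F i) (p - r) := by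
    intro r
    induction r with
    | zero => exact fun _ => ⟨0, by simp, by simp, by simpa using hΔ⟩
    | succ r ih =>
      intro hr
      obtain ⟨e, he, he0, hord⟩ := ih (by lia)
      set Y := Δ - ∑ i ∈ Finset.range r, e i • F i with hY
      have hYn : OrdLE (nabla δ' B' Y) p := by
        rw [hY, map_sub, map_sum]
        refine (h'.mono (by lia)).sub (OrdLE.sum fun i hi => ?_)
        rw [nabla_smul (he i)]
        exact (((hF i).ordLE.mono (by lia)).smul _).add
          (((hFn' i (by have := Finset.mem_range.mp hi; lia)).mono (by lia)).smul _)
      have hc := coeff_nabla (δ := δ') (by lia) hB' hord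
      rw [hYn _ (by push_cast; lia)] at hc
      have hD : D (Y.coeff (p - r)) = 0 := by
        have h0 : (m + 1) • D (Y.coeff (p - r)) = 0 := by
          rw [nsmul_eq_mul]
          simpa using hc
        exact (nsmul_eq_zero_iff_right (by lia)).mp h0
      refine ⟨Function.update e r (Y.coeff (p - r)), fun i => ?_, fun _ => ?_, ?_⟩
      · by_cases hi : i = r
        · subst hi; simpa using hD
        · simpa [hi] using he i
      · rcases Nat.eq_zero_or_pos r with rfl | hr0
        · simp [hY]
        · rw [Function.update_of_ne hr0.ne]
          exact he0 hr0.ne'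
      · rw [Finset.sum_range_succ, Function.update_self,
          Finset.sum_congr rfl (g := fun i => e i • F i) fun i hi => by
            rw [Function.update_of_ne (Finset.mem_range.mp hi).ne], ← sub_sub, ← hY,
          Nat.cast_succ, ← sub_sub]
        refine (hord.sub ((hF r).ordLE.smul _)).of_coeff_eq_zero ?_
        rw [coeff_sub, coeff_smul, (hF r).1, mul_one, sub_self]
  obtain ⟨e, he, he0, hord⟩ := key m le_rfl
  have he0 := he0 hm
  refine ⟨he0 ▸ he 0, ?_⟩
  -- After m steps the remainder has order at most p - m, so its ∇ has order below p. In order p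
  -- only δ(e 0) survives.
  have hn := ordLE_nabla (δ := δ) (by lia) hB hord p (by lia)
  rw [map_sub, coeff_sub, h p (by lia), zero_sub, neg_eq_zero, map_sum, coeff_sum,
    Finset.sum_eq_single 0] at hn
  · rw [nabla_smul (he 0), coeff_add, coeff_smul, coeff_smul, hFn 0 (by lia) p (by lia), mul_zero,
      add_zero] at hn
    have h1 := (hF 0).1
    rw [Nat.cast_zero, sub_zero] at h1
    rwa [h1, mul_one, he0] at hn
  · intro i hi hi0
    rw [nabla_smul (he i), coeff_add, coeff_smul, coeff_smul,
      hFn i (Finset.mem_range.mp hi) p (by lia), (hF i).ordLE p (by lia), mul_zero, mul_zero,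
      add_zero]
  · intro h0
    exact absurd (Finset.mem_range.mpr (Nat.pos_of_ne_zero hm)) h0

end MicroDiffOp

end

/-! ### Asymptotically horizontal sequences and the construction of L. -/

noncomputable section

namespace MicroDiffOp

open Filter

variable {R : Type u} [CommRing R] {D : R →+ R}

/-- The operators `N n` become horizontal for all the covariant derivatives as `n → ∞`. -/
def AsymptoticallyHorizontal (δ : ℕ+ → R →+ R) (B : ℕ+ → MicroDiffOp D)
    (N : ℕ → MicroDiffOp D) : Prop :=
  ∀ (m : ℕ+) (s : ℤ), ∀ᶠ n in atTop, OrdLE (nabla (δ m) (B m) (N n)) s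

/-- Series of elements of `ker D` whose terms are eventually killed by each `δ m` can be summed, up
to a sequence of elements killed by all the `δ m`. -/
def HasConstantSums (D : R →+ R) (δ : ℕ+ → R →+ R) : Prop :=
  ∀ e : ℕ → R, (∀ n, D (e n) = 0) → (∀ m, ∀ᶠ n in atTop, δ m (e n) = 0) →
    ∃ f, D f = 0 ∧ ∀ m, ∀ᶠ n in atTop, δ m (f - ∑ k ∈ Finset.range n, e k) = 0

section

variable [IsLeibniz D] {δ : ℕ+ → R →+ R} [∀ m, IsLeibniz (δ m)] {B : ℕ+ → MicroDiffOp D}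

/-- The quotients `F n = B_{n+j} B_n⁻¹` are monic of order `j` and asymptotically horizontal. -/
theorem exists_quotient (hδ : ∀ m a, δ m (D a) = D (δ m a))
    (hB : ∀ n, (B n).IsMonicOfOrder (n : ℤ)) (hZS : ZakharovShabat δ B) (j : ℤ) :
    ∃ F : ℕ → MicroDiffOp D, (∀ n, (F n).IsMonicOfOrder j) ∧ AsymptoticallyHorizontal δ B F ∧
      ((∀ n : ℕ+, (B n).coeff ((n : ℤ) - 1) = 0) → ∀ᶠ n in atTop, (F n).coeff (j - 1) = 0) := by
  have hnablaB : ∀ m n : ℕ+, nabla (δ m) (B m) (B n) = mapCoeff (δ n) (B m) := by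
    intro m n
    have h := hZS n m
    rw [commutator] at h
    rw [nabla_apply, ← sub_eq_zero, ← h]
    abel
  have hdB : ∀ m n : ℕ+, OrdLE (mapCoeff (δ n) (B m)) (m - 1) := fun m n =>
    ((hB m).ordLE.mapCoeff _).of_coeff_eq_zero (by rw [coeff_mapCoeff, (hB m).1, IsLeibniz.map_one])
  have key : ∀ n : ℕ, ∃ X : MicroDiffOp D, X.IsMonicOfOrder j ∧ (1 ≤ n → 1 ≤ n + j →
      (∀ m : ℕ+, OrdLE (nabla (δ m) (B m) X) (max 0 j + m - 1 - n)) ∧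
      ((∀ n : ℕ+, (B n).coeff ((n : ℤ) - 1) = 0) → X.coeff (j - 1) = 0)) := by
    intro n
    by_cases hn : 1 ≤ n ∧ 1 ≤ n + j
    · obtain ⟨hn1, hnj⟩ := hn
      obtain ⟨a, rfl⟩ : ∃ a : ℕ+, (a : ℕ) = n := ⟨⟨n, hn1⟩, rfl⟩
      obtain ⟨b, hb⟩ : ∃ b : ℕ+, (b : ℤ) = a + j := ⟨⟨(a + j).toNat, by lia⟩, by simp; lia⟩
      obtain ⟨X, hX, hXB⟩ := exists_mul_eq_of_monic (hB a) (hB b).ordLE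
      rw [show (b : ℤ) - (a : ℕ) = j by lia] at hX
      have hj : X.coeff j = 1 := by
        have h := coeff_mul_add hX (hB a).ordLE
        rwa [hXB, (hB a).1, mul_one, show j + (a : ℕ) = (b : ℤ) by lia, (hB b).1, eq_comm] at h
      refine ⟨X, ⟨hj, hX⟩, fun _ _ => ⟨fun m => ?_, fun h0 => ?_⟩⟩
      -- From X B_a = B_b one gets (∇X) B_a = ∇B_b - X ∇B_a, of order at most max(0, j) + m - 1;
      -- cancelling B_a lowers this by a.
      · refine OrdLE.of_mul_monic (hB a) ?_
        have h := nabla_mul (hδ m) (B m) X (B a)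
        rw [hXB, hnablaB, hnablaB] at h
        rw [← sub_eq_iff_eq_add.mpr h]
        exact ((hdB m b).mono (by lia)).sub ((hX.mul (hdB m a)).mono (by lia))
      · have h := coeff_mul_add_sub_one hX (hB a).ordLE
        rw [hXB, show j + (a : ℕ) - 1 = (b : ℤ) - 1 by lia, h0, h0, (hB a).1, IsLeibniz.map_one] at h
        simpa using h.symm
    · exact ⟨monomial D j 1, ⟨by simp [coeff_monomial], ordLE_monomial j 1⟩,
        fun h1 h2 => absurd ⟨h1, h2⟩ hn⟩
  choose F hF hF' using key
  refine ⟨F, hF, fun m s => ?_, fun h0 => ?_⟩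
  · filter_upwards [eventually_ge_atTop (max (1 + (-j).toNat) (max 0 j + m - 1 - s).toNat)] with n hn
    exact ((hF' n (by lia) (by lia)).1 m).mono (by lia)
  · filter_upwards [eventually_ge_atTop (1 + (-j).toNat)] with n hn
    exact (hF' n (by lia) (by lia)).2 h0

/-- The leading coefficients of the successive differences of an asymptotically horizontal sequence
are asymptotically constant. -/
theorem eventually_leadingCoeff_const [IsAddTorsionFree R]
    (hB : ∀ n, (B n).IsMonicOfOrder (n : ℤ)) {F : ℤ → ℕ → MicroDiffOp D}
    (hF : ∀ j n, (F j n).IsMonicOfOrder j) (hFh : ∀ j, AsymptoticallyHorizontal δ B (F j))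
    {Δ : ℕ → MicroDiffOp D} (hΔh : AsymptoticallyHorizontal δ B Δ) {p : ℤ}
    (hΔ : ∀ᶠ n in atTop, OrdLE (Δ n) p) (m : ℕ+) :
    ∀ᶠ n in atTop, D ((Δ n).coeff p) = 0 ∧ δ m ((Δ n).coeff p) = 0 := by
  have hfin : ∀ m' : ℕ+, ∀ᶠ n in atTop, ∀ i ∈ Finset.range m,
      OrdLE (nabla (δ m') (B m') (F (p - i) n)) (p - 1) := fun m' =>
    (eventually_all_finset _).mpr fun i _ => hFh (p - i) m' (p - 1)
  filter_upwards [hΔ, hΔh m (p - 1), hΔh (m + 1) (p - 1), hfin m, hfin (m + 1)]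
    with n h1 h2 h3 h4 h5
  exact leadingCoeff_const m.ne_zero (hB m) (by simpa using hB (m + 1)) h1
    (fun i => hF (p - i) n) h2 h3 (fun i hi => h4 i (Finset.mem_range.mpr hi))
    (fun i hi => h5 i (Finset.mem_range.mpr hi))

/-- Correcting an asymptotically horizontal sequence in order `p` makes it stationary there. -/
theorem exists_stationary_correction [IsAddTorsionFree R] (hsum : HasConstantSums D δ)
    (hB : ∀ n, (B n).IsMonicOfOrder (n : ℤ)) {F : ℤ → ℕ → MicroDiffOp D}
    (hF : ∀ j n, (F j n).IsMonicOfOrder j) (hFh : ∀ j, AsymptoticallyHorizontal δ B (F j))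
    (p : ℤ) (N : ℕ → MicroDiffOp D) (hN : AsymptoticallyHorizontal δ B N)
    (hNp : ∀ᶠ n in atTop, OrdLE (N n - N (n + 1)) p) :
    ∃ N' : ℕ → MicroDiffOp D, AsymptoticallyHorizontal δ B N' ∧
      (∀ᶠ n in atTop, OrdLE (N' n - N' (n + 1)) (p - 1)) ∧ ∀ n, OrdLE (N' n - N n) p := by
  classical
  have hΔ : AsymptoticallyHorizontal δ B fun n => N n - N (n + 1) := fun m s => by
    filter_upwards [hN m s, (tendsto_add_atTop_nat 1).eventually (hN m s)] with n h1 h2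
    rw [map_sub]
    exact h1.sub h2
  have hconst := eventually_leadingCoeff_const hB hF hFh hΔ hNp
  -- The default 0 makes every term constant in x; it is used for only finitely many n.
  let e : ℕ → R := fun n => if D ((N n - N (n + 1)).coeff p) = 0 then
    (N n - N (n + 1)).coeff p else 0
  have he : ∀ n, D (e n) = 0 := fun n => by
    simp only [e]; split_ifs with h
    · exact h
    · exact map_zero D
  obtain ⟨f, hf, hfe⟩ := hsum e he fun m => by
    filter_upwards [hconst m] with n hn
    simp only [e]
    rw [if_pos hn.1]
    exact hn.2
  let c : ℕ → R := fun n => f - ∑ k ∈ Finset.range n, e k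
  have hc : ∀ n, D (c n) = 0 := fun n => by
    simp [c, hf, map_sum, he]
  refine ⟨fun n => N n - c n • F p n, fun m s => ?_, ?_, fun n => ?_⟩
  · filter_upwards [hN m s, hFh p m s, hfe m] with n h1 h2 h3
    rw [map_sub, nabla_smul (hc n), show δ m (c n) = 0 from h3]
    refine h1.sub (OrdLE.add (fun k _ => ?_) (h2.smul _))
    rw [coeff_smul, zero_mul]
  · filter_upwards [hNp, hconst 1] with n h1 h2
    have h3 : OrdLE (c n • F p n - c (n + 1) • F p (n + 1)) p :=
      ((hF p n).ordLE.smul _).sub ((hF p (n + 1)).ordLE.smul _)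
    rw [sub_sub_sub_comm]
    refine (h1.sub h3).of_coeff_eq_zero ?_
    have h4 : e n = (N n - N (n + 1)).coeff p := if_pos h2.1
    rw [coeff_sub, ← h4, coeff_sub, coeff_smul, coeff_smul, (hF p n).1, (hF p (n + 1)).1]
    simp only [c, Finset.sum_range_succ]
    ring
  · rw [sub_sub_cancel_left]
    intro k hk
    rw [coeff_neg, (hF p n).ordLE.smul (c n) k hk, neg_zero]

/-- An asymptotically horizontal sequence that is stationary in orders above `p` coincides there
with a horizontal operator. -/
theorem exists_horizontal [IsAddTorsionFree R] (hsum : HasConstantSums D δ)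
    (hB : ∀ n, (B n).IsMonicOfOrder (n : ℤ)) {F : ℤ → ℕ → MicroDiffOp D}
    (hF : ∀ j n, (F j n).IsMonicOfOrder j) (hFh : ∀ j, AsymptoticallyHorizontal δ B (F j))
    (p : ℤ) (N : ℕ → MicroDiffOp D) (hN : AsymptoticallyHorizontal δ B N)
    (hNp : ∀ᶠ n in atTop, OrdLE (N n - N (n + 1)) p) :
    ∃ L : MicroDiffOp D, (∀ m, nabla (δ m) (B m) L = 0) ∧
      ∀ᶠ n in atTop, OrdLE (L - N n) p := by
  choose! next hnext using exists_stationary_correction hsum hB hF hFh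
  let G : ℕ → ℕ → MicroDiffOp D := Nat.rec N fun k Nk => next (p - k) Nk
  have hG : ∀ k : ℕ, AsymptoticallyHorizontal δ B (G k) ∧
      ∀ᶠ n in atTop, OrdLE (G k n - G k (n + 1)) (p - k) := by
    intro k
    induction k with
    | zero => exact ⟨hN, by simpa [G] using hNp⟩
    | succ k ih =>
      obtain ⟨h1, h2, -⟩ := hnext (p - k) (G k) ih.1 ih.2
      refine ⟨h1, ?_⟩
      rw [Nat.cast_succ, ← sub_sub]
      exact h2
  have hGG : ∀ k n : ℕ, OrdLE (G (k + 1) n - G k n) (p - k) := fun k =>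
    (hnext (p - k) (G k) (hG k).1 (hG k).2).2.2
  have hstab : ∀ k : ℕ, ∃ n₀, ∀ n ≥ n₀, OrdLE (G k n₀ - G k n) (p - k) := by
    intro k
    obtain ⟨n₀, h⟩ := eventually_atTop.mp (hG k).2
    refine ⟨n₀, fun n hn => ?_⟩
    induction n, hn using Nat.le_induction with
    | base => rw [sub_self]; exact OrdLE.zero
    | succ n hn ih => exact ih.trans (h n hn)
  choose ν hν using hstab
  obtain ⟨L, hL⟩ := exists_limit (M := fun k => G k (ν k)) (p := p) fun k => by
    have h1 := (hν (k + 1) (max (ν k) (ν (k + 1))) (le_max_right _ _)).mono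
      (show _ ≤ p - k by push_cast; lia)
    have h2 := hν k (max (ν k) (ν (k + 1))) (le_max_left _ _)
    exact (h1.trans (hGG k _)).trans h2.sub_comm
  have hLG : ∀ k n : ℕ, ν k ≤ n → OrdLE (L - G k n) (p - k) := fun k n hn =>
    (hL k).trans (hν k n hn)
  refine ⟨L, fun m => eq_zero_of_forall_ordLE fun s => ?_, ?_⟩
  -- Chosen so that ∇ of an operator of order p - k has order at most s.
  · let k := (p + m - 1 - s).toNat
    obtain ⟨n, h1, h2⟩ := (((hG k).1 m s).and (eventually_ge_atTop (ν k))).exists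
    have h3 := ordLE_nabla (δ := δ m) (by have := m.pos; lia) (hB m) (hLG k n h2)
    rw [map_sub] at h3
    have h4 := (h3.mono (show _ ≤ s by lia)).add h1
    rwa [sub_add_cancel] at h4
  · filter_upwards [eventually_ge_atTop (ν 0)] with n hn
    simpa [G] using hLG 0 n hn

theorem exists_lax [IsAddTorsionFree R] (hsum : HasConstantSums D δ)
    (hδ : ∀ m a, δ m (D a) = D (δ m a))
    (hB : ∀ n, (B n).IsMonicOfOrder (n : ℤ)) (hZS : ZakharovShabat δ B) :
    ∃ L : MicroDiffOp D, L.IsMonicOfOrder 1 ∧ LaxEquations δ B L ∧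
      ((∀ n : ℕ+, (B n).coeff ((n : ℤ) - 1) = 0) → L.coeff 0 = 0) := by
  choose F hF hFh hF0 using exists_quotient hδ hB hZS
  have hdiff : ∀ n, OrdLE (F 1 n - F 1 (n + 1)) 0 := fun n =>
    ((hF 1 n).ordLE.sub (hF 1 (n + 1)).ordLE).of_coeff_eq_zero
      (by rw [coeff_sub, (hF 1 n).1, (hF 1 (n + 1)).1, sub_self])
  have hmonic : ∀ {L : MicroDiffOp D} {n : ℕ}, OrdLE (L - F 1 n) 0 → L.IsMonicOfOrder 1 := by
    intro L n h
    have hk : ∀ k : ℤ, 0 < k → L.coeff k = (F 1 n).coeff k := fun k hk => sub_eq_zero.mp (h k hk)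
    exact ⟨(hk 1 one_pos).trans (hF 1 n).1,
      fun k h1 => (hk k (by lia)).trans ((hF 1 n).ordLE k h1)⟩
  by_cases h0 : ∀ n : ℕ+, (B n).coeff ((n : ℤ) - 1) = 0
  · have hsub : ∀ᶠ n in atTop, (F 1 n).coeff 0 = 0 := by simpa using hF0 1 h0
    obtain ⟨L, hL, hLF⟩ := exists_horizontal hsum hB hF hFh (-1) (F 1) (hFh 1) (by
      filter_upwards [hsub, (tendsto_add_atTop_nat 1).eventually hsub] with n h1 h2
      exact (hdiff n).of_coeff_eq_zero (by rw [coeff_sub, h1, h2, sub_self]))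
    obtain ⟨n, h1, h2⟩ := (hLF.and hsub).exists
    refine ⟨L, hmonic (h1.mono (by lia)), fun m => sub_eq_zero.mp (hL m), fun _ => ?_⟩
    exact (sub_eq_zero.mp (h1 0 (by lia))).trans h2
  · obtain ⟨L, hL, hLF⟩ := exists_horizontal hsum hB hF hFh 0 (F 1) (hFh 1)
      (Eventually.of_forall hdiff)
    obtain ⟨n, h1⟩ := hLF.exists
    exact ⟨L, hmonic h1, fun m => sub_eq_zero.mp (hL m), fun h => absurd h h0⟩

end

end MicroDiffOp

end

/-! ### Summing constants in 𝒞, and verification for 𝒞[[x]] and 𝒞((x)). -/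

noncomputable section

open Filter MicroDiffOp

theorem MvPowerSeries.coeff_eq_zero_of_pderiv_eq_zero {σ A : Type*} [CommRing A]
    [IsAddTorsionFree A] {i : σ} {f : MvPowerSeries σ A} (hf : MvPowerSeries.pderiv A i f = 0)
    {n : σ →₀ ℕ} (hn : n i ≠ 0) : MvPowerSeries.coeff n f = 0 := by
  have hle : Finsupp.single i 1 ≤ n := Finsupp.single_le_iff.mpr (Nat.one_le_iff_ne_zero.mpr hn)
  have h := congrArg (MvPowerSeries.coeff (n - Finsupp.single i 1)) hf
  rw [MvPowerSeries.coeff_pderiv, tsub_add_cancel_of_le hle, map_zero, ← Nat.cast_succ, mul_comm,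
    ← nsmul_eq_mul] at h
  exact (nsmul_eq_zero_iff_right (Nat.succ_ne_zero _)).mp h

/-- Time series that eventually do not depend on each given time can be summed, up to constants. -/
theorem exists_timeSeries_sum {A : Type*} [CommRing A] [IsAddTorsionFree A]
    (e : ℕ → TimeSeries A) (he : ∀ m, ∀ᶠ n in atTop, MvPowerSeries.pderiv A m (e n) = 0) :
    ∃ f : TimeSeries A, ∀ m, ∀ᶠ n in atTop,
      MvPowerSeries.pderiv A m (f - ∑ k ∈ Finset.range n, e k) = 0 := by
  -- For α ≠ 0 the sum is finite. For α = 0 it may be infinite, with junk value 0, which no time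
  -- derivative sees.
  let f : TimeSeries A := fun α => ∑ᶠ k, MvPowerSeries.coeff α (e k)
  have hf : ∀ α, MvPowerSeries.coeff α f = ∑ᶠ k, MvPowerSeries.coeff α (e k) := fun _ => rfl
  refine ⟨f, fun m => ?_⟩
  obtain ⟨n₀, hn₀⟩ := eventually_atTop.mp (he m)
  filter_upwards [eventually_ge_atTop n₀] with n hn
  ext α
  have hα : (α + Finsupp.single m 1 : ℕ+ →₀ ℕ) m ≠ 0 := by simp
  rw [MvPowerSeries.coeff_pderiv, map_sub, map_sum, hf,
    finsum_eq_sum_of_support_subset (s := Finset.range n), sub_self, zero_mul, map_zero]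
  intro k hk
  by_contra hkn
  rw [Finset.mem_coe, Finset.mem_range, not_lt] at hkn
  exact hk (MvPowerSeries.coeff_eq_zero_of_pderiv_eq_zero (hn₀ k (hn.trans hkn)) hα)

/-- When ker D is a copy of 𝒞 compatible with the time derivatives, the sum can be formed in 𝒞 and
transported. -/
theorem hasConstantSums_of_constants {A : Type*} [CommRing A] [IsAddTorsionFree A] {R : Type*}
    [CommRing R] {D : R →+ R} {δ : ℕ+ → R →+ R} (ι : TimeSeries A →+ R)
    (hι : Function.Injective ι) (hD : ∀ c, D (ι c) = 0) (hker : ∀ a, D a = 0 → ∃ c, ι c = a)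
    (hδ : ∀ m c, δ m (ι c) = ι (MvPowerSeries.pderiv A m c)) : HasConstantSums D δ := by
  intro e he heδ
  choose g hg using fun n => hker (e n) (he n)
  obtain ⟨f, hf⟩ := exists_timeSeries_sum g fun m => by
    filter_upwards [heδ m] with n hn
    rw [← hg, hδ] at hn
    exact hι (hn.trans (map_zero ι).symm)
  refine ⟨ι f, hD f, fun m => ?_⟩
  filter_upwards [hf m] with n hn
  simp only [← hg]
  rw [← map_sum, ← map_sub, hδ, hn, map_zero]

theorem isAddTorsionFree_of_complex (M : Type*) [AddCommGroup M] [Module ℂ M] :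
    IsAddTorsionFree M :=
  letI := Module.compHom M (algebraMap ℚ ℂ)
  .of_module_rat M

/-! ### The case 𝒞[[x]]. -/

section PowerSeries

variable (A : Type u) [CommRing A]

theorem coeff_powerSeriesDx (f : PowerSeries (TimeSeries A)) (k : ℕ) :
    PowerSeries.coeff k (powerSeriesDx A f) = PowerSeries.coeff (k + 1) f * (k + 1) :=
  PowerSeries.coeff_derivative f k

theorem coeff_powerSeriesDt (n : ℕ+) (f : PowerSeries (TimeSeries A)) (k : ℕ) :
    PowerSeries.coeff k (powerSeriesDt A n f) =
      MvPowerSeries.pderiv A n (PowerSeries.coeff k f) :=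
  PowerSeries.coeff_mk k fun k => MvPowerSeries.pderiv A n (PowerSeries.coeff k f)

instance : IsLeibniz (powerSeriesDx A) where
  map_mul a b := by
    refine ((PowerSeries.derivative (TimeSeries A)).leibniz a b).trans ?_
    rw [smul_eq_mul, smul_eq_mul, mul_comm b]
    rfl

instance (n : ℕ+) : IsLeibniz (powerSeriesDt A n) where
  map_mul a b := by
    ext1 k
    simp only [map_add, coeff_powerSeriesDt, PowerSeries.coeff_mul, map_sum,
      Derivation.leibniz, smul_eq_mul, Finset.sum_add_distrib]
    congr 1
    exact Finset.sum_congr rfl fun _ _ => mul_comm _ _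

theorem pderiv_mul_natCast_add_one (n : ℕ+) (c : TimeSeries A) (k : ℕ) :
    MvPowerSeries.pderiv A n (c * (k + 1)) = MvPowerSeries.pderiv A n c * (k + 1) := by
  have h : c * ((k : TimeSeries A) + 1) = (k + 1) • c := by
    rw [nsmul_eq_mul, Nat.cast_succ, mul_comm]
  rw [h, map_nsmul, nsmul_eq_mul, Nat.cast_succ, mul_comm]

theorem powerSeriesDt_dx (n : ℕ+) (f : PowerSeries (TimeSeries A)) :
    powerSeriesDt A n (powerSeriesDx A f) = powerSeriesDx A (powerSeriesDt A n f) := by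
  ext1 k
  rw [coeff_powerSeriesDt, coeff_powerSeriesDx, coeff_powerSeriesDx, coeff_powerSeriesDt,
    pderiv_mul_natCast_add_one]

theorem hasConstantSums_powerSeries [Algebra ℂ A] :
    HasConstantSums (powerSeriesDx A) (powerSeriesDt A) := by
  have := isAddTorsionFree_of_complex A
  have := isAddTorsionFree_of_complex (TimeSeries A)
  refine hasConstantSums_of_constants (PowerSeries.C (R := TimeSeries A)).toAddMonoidHom
    PowerSeries.C_injective (fun c => ?_) (fun a ha => ⟨PowerSeries.coeff 0 a, ?_⟩) fun m c => ?_
  · exact PowerSeries.derivative_C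
  · ext1 k
    rcases k with _ | k
    · simp
    · have h := congrArg (PowerSeries.coeff k) ha
      rw [coeff_powerSeriesDx, map_zero, ← Nat.cast_succ, mul_comm, ← nsmul_eq_mul] at h
      rw [(nsmul_eq_zero_iff_right (Nat.succ_ne_zero k)).mp h]
      simp
  · ext1 k
    rw [coeff_powerSeriesDt]
    simp only [RingHom.toAddMonoidHom_eq_coe, AddMonoidHom.coe_coe, PowerSeries.coeff_C]
    split_ifs <;> simp

end PowerSeries

/-! ### The case 𝒞((x)). -/

section LaurentSeries

variable (A : Type u) [CommRing A]

theorem coeff_laurentSeriesDx (f : LaurentSeries (TimeSeries A)) (k : ℤ) :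
    (laurentSeriesDx A f).coeff k = (k + 1) • f.coeff (k + 1) := by
  refine (LaurentSeries.hasseDeriv_coeff (R := TimeSeries A) 1 f k).trans ?_
  rw [Nat.cast_one, Ring.choose_one_right]

theorem coeff_laurentSeriesDt (n : ℕ+) (f : LaurentSeries (TimeSeries A)) (k : ℤ) :
    (laurentSeriesDt A n f).coeff k = MvPowerSeries.pderiv A n (f.coeff k) := rfl

theorem LaurentSeries.exists_coeff_eq_zero {S : Type*} [CommRing S] (f : LaurentSeries S) :
    ∃ a : ℤ, ∀ i < a, f.coeff i = 0 :=
  ⟨f.order, fun _ => HahnSeries.coeff_eq_zero_of_lt_order⟩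

/-- The range depends only on lower bounds for the supports, not on the supports themselves, so
products involving derivatives can be compared termwise. -/
theorem LaurentSeries.coeff_mul_eq_sum_Icc {S : Type*} [CommRing S] {f g : LaurentSeries S}
    {a b : ℤ} (hf : ∀ i < a, f.coeff i = 0) (hg : ∀ i < b, g.coeff i = 0) (k : ℤ) :
    (f * g).coeff k = ∑ i ∈ Finset.Icc a (k - b), f.coeff i * g.coeff (k - i) := by
  rw [HahnSeries.coeff_mul]
  refine Finset.sum_of_injOn Prod.fst ?_ ?_ ?_ ?_
  · rintro ⟨i, j⟩ h ⟨i', j'⟩ h' (rfl : i = i')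
    simp only [Finset.mem_coe, Finset.mem_antidiagonal] at h h'
    exact Prod.ext rfl (by simp only; lia)
  · rintro ⟨i, j⟩ h
    simp only [Finset.mem_coe, Finset.mem_antidiagonal, HahnSeries.mem_support] at h
    obtain ⟨h1, h2, rfl⟩ := h
    have h3 : a ≤ i := not_lt.mp fun h => h1 (hf i h)
    have h4 : b ≤ j := not_lt.mp fun h => h2 (hg j h)
    simp only [Finset.coe_Icc, Set.mem_Icc]
    lia
  · intro i _ hi
    by_contra hne
    refine hi ⟨(i, k - i), ?_, rfl⟩
    rw [Finset.mem_coe, Finset.mem_antidiagonal]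
    exact ⟨left_ne_zero_of_mul hne, right_ne_zero_of_mul hne, by ring⟩
  · rintro ⟨i, j⟩ h
    rw [Finset.mem_antidiagonal] at h
    simp only at h ⊢
    rw [← h.2.2, add_sub_cancel_left]

instance : IsLeibniz (laurentSeriesDx A) where
  map_mul f g := by
    obtain ⟨a, ha⟩ := LaurentSeries.exists_coeff_eq_zero f
    obtain ⟨b, hb⟩ := LaurentSeries.exists_coeff_eq_zero g
    have ha' : ∀ i < a - 1, (laurentSeriesDx A f).coeff i = 0 := fun i hi => by
      rw [coeff_laurentSeriesDx, ha _ (by lia), smul_zero]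
    have hb' : ∀ i < b - 1, (laurentSeriesDx A g).coeff i = 0 := fun i hi => by
      rw [coeff_laurentSeriesDx, hb _ (by lia), smul_zero]
    ext1
    funext k
    rw [HahnSeries.coeff_add, coeff_laurentSeriesDx, LaurentSeries.coeff_mul_eq_sum_Icc ha hb,
      LaurentSeries.coeff_mul_eq_sum_Icc ha hb', LaurentSeries.coeff_mul_eq_sum_Icc ha' hb]
    have hshift : ∑ i ∈ Finset.Icc (a - 1) (k - b),
        (laurentSeriesDx A f).coeff i * g.coeff (k - i) =
        ∑ i ∈ Finset.Icc a (k - (b - 1)), (i • f.coeff i) * g.coeff (k + 1 - i) := by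
      refine Finset.sum_nbij' (fun i => i + 1) (fun i => i - 1) ?_ ?_ ?_ ?_ ?_
      · simp; lia
      · simp; lia
      · simp
      · simp
      · intro i _
        rw [coeff_laurentSeriesDx, add_sub_add_right_eq_sub]
    -- With the ranges aligned, the Leibniz rule becomes k + 1 = (k + 1 - i) + i in each term.
    rw [hshift, ← Finset.sum_add_distrib, show k + 1 - b = k - (b - 1) by ring, Finset.smul_sum]
    refine Finset.sum_congr rfl fun i _ => ?_
    rw [coeff_laurentSeriesDx, show k - i + 1 = k + 1 - i by ring, smul_mul_assoc, mul_smul_comm,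
      ← add_smul, sub_add_cancel]

instance (n : ℕ+) : IsLeibniz (laurentSeriesDt A n) where
  map_mul f g := by
    obtain ⟨a, ha⟩ := LaurentSeries.exists_coeff_eq_zero f
    obtain ⟨b, hb⟩ := LaurentSeries.exists_coeff_eq_zero g
    have ha' : ∀ i < a, (laurentSeriesDt A n f).coeff i = 0 := fun i hi => by
      rw [coeff_laurentSeriesDt, ha i hi, map_zero]
    have hb' : ∀ i < b, (laurentSeriesDt A n g).coeff i = 0 := fun i hi => by
      rw [coeff_laurentSeriesDt, hb i hi, map_zero]
    ext1
    funext k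
    rw [HahnSeries.coeff_add, coeff_laurentSeriesDt, LaurentSeries.coeff_mul_eq_sum_Icc ha hb,
      LaurentSeries.coeff_mul_eq_sum_Icc ha hb', LaurentSeries.coeff_mul_eq_sum_Icc ha' hb, map_sum,
      ← Finset.sum_add_distrib]
    refine Finset.sum_congr rfl fun i _ => ?_
    rw [Derivation.leibniz, smul_eq_mul, smul_eq_mul, coeff_laurentSeriesDt, coeff_laurentSeriesDt,
      mul_comm (g.coeff _)]

theorem laurentSeriesDt_dx (n : ℕ+) (f : LaurentSeries (TimeSeries A)) :
    laurentSeriesDt A n (laurentSeriesDx A f) = laurentSeriesDx A (laurentSeriesDt A n f) := by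
  ext1
  funext k
  rw [coeff_laurentSeriesDt, coeff_laurentSeriesDx, coeff_laurentSeriesDx, coeff_laurentSeriesDt,
    map_zsmul]

theorem hasConstantSums_laurentSeries [Algebra ℂ A] :
    HasConstantSums (laurentSeriesDx A) (laurentSeriesDt A) := by
  have := isAddTorsionFree_of_complex A
  have := isAddTorsionFree_of_complex (TimeSeries A)
  refine hasConstantSums_of_constants (HahnSeries.C (Γ := ℤ) (R := TimeSeries A)).toAddMonoidHom
    HahnSeries.C_injective (fun c => ?_) (fun f hf => ⟨f.coeff 0, ?_⟩) fun m c => ?_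
  · ext1
    funext k
    rw [coeff_laurentSeriesDx]
    simp only [RingHom.toAddMonoidHom_eq_coe, AddMonoidHom.coe_coe, HahnSeries.C_apply,
      HahnSeries.coeff_single, HahnSeries.coeff_zero]
    split_ifs with h
    · rw [h, zero_smul]
    · rw [smul_zero]
  · ext1
    funext k
    simp only [RingHom.toAddMonoidHom_eq_coe, AddMonoidHom.coe_coe, HahnSeries.C_apply,
      HahnSeries.coeff_single]
    split_ifs with h
    · rw [h]
    -- The coefficient of x^{k-1} in f' is k f_k, so f_k = 0 for k ≠ 0 by torsion-freeness.
    · have h1 := congrArg (fun g => HahnSeries.coeff g (k - 1)) hf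
      simp only [coeff_laurentSeriesDx, sub_add_cancel, HahnSeries.coeff_zero] at h1
      exact (zsmul_right_injective h (h1.trans (smul_zero k).symm)).symm
  · ext1
    funext k
    rw [coeff_laurentSeriesDt]
    simp only [RingHom.toAddMonoidHom_eq_coe, AddMonoidHom.coe_coe, HahnSeries.C_apply,
      HahnSeries.coeff_single]
    split_ifs
    · rfl
    · exact map_zero _

end LaurentSeries

end

theorem mainTheorem2 (A : Type*) [CommRing A] [Algebra ℂ A] :
    (∀ B : ℕ+ → MicroDiffOp (powerSeriesDx A),
      (∀ n, (B n).IsDifferential ∧ (B n).IsMonicOfOrder (n : ℤ)) →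
      MicroDiffOp.ZakharovShabat (powerSeriesDt A) B →
      ∃ L : MicroDiffOp (powerSeriesDx A),
        L.IsMonicOfOrder 1 ∧
        MicroDiffOp.LaxEquations (powerSeriesDt A) B L ∧
        ((∀ n : ℕ+, (B n).coeff ((n : ℤ) - 1) = 0) → L.coeff 0 = 0)) ∧
    (∀ B : ℕ+ → MicroDiffOp (laurentSeriesDx A),
      (∀ n, (B n).IsDifferential ∧ (B n).IsMonicOfOrder (n : ℤ)) →
      MicroDiffOp.ZakharovShabat (laurentSeriesDt A) B →
      ∃ L : MicroDiffOp (laurentSeriesDx A),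
        L.IsMonicOfOrder 1 ∧
        MicroDiffOp.LaxEquations (laurentSeriesDt A) B L ∧
        ((∀ n : ℕ+, (B n).coeff ((n : ℤ) - 1) = 0) → L.coeff 0 = 0)) := by
  have := isAddTorsionFree_of_complex (PowerSeries (TimeSeries A))
  have := isAddTorsionFree_of_complex (LaurentSeries (TimeSeries A))
  exact ⟨fun B hB hZS => MicroDiffOp.exists_lax (hasConstantSums_powerSeries A)
      (powerSeriesDt_dx A) (fun n => (hB n).2) hZS,
    fun B hB hZS => MicroDiffOp.exists_lax (hasConstantSums_laurentSeries A)
      (laurentSeriesDt_dx A) (fun n => (hB n).2) hZS⟩
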